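/- Let $n\ge 0$ and $k\ge 1$ be integers. The extended Shi arrangement $\mathcal S_n^k$ in $\mathbb R^n$ consists of the hyperplanes $x_i-x_j=l$ for $1\le i<j\le n$ and $l=-k+1,-k+2,\dots,k$; its regions are the connected components of the complement in $\mathbb R^n$ of the union of these hyperplanes. A $k$-parking function on $[n]=\{1,\dots,n\}$ is a sequence of positive integers $f=(a_1,\dots,a_n)$ whose increasing rearrangement $b_1\le b_2\le\dots\le b_n$ satisfies $b_i\le 1+k(i-1)$ for all $i$. To a region $R$ of $\mathcal S_n^k$ associate a diagram as follows. Let $y_1y_2\cdots y_{kn}$ be the unique permutation of the variables $x_i+m$ ($1\le i\le n$, $0\le m\le k-1$) such that $y_1>y_2>\dots>y_{kn}$ holds on $R$. Draw an arc from $x_i+m$ to $x_i+m-1$ for all $i$ and all $1\le m\le k-1$, and an arc from $x_i$ to $x_j+k-1$ whenever $i<j$ and $x_i-x_j>k$ holds on $R$. Then remove every arc that contains another arc, where an arc from $y_p$ to $y_q$ contains a different arc from $y_r$ to $y_s$ if $p\le r$ and $s\le q$. The remaining arcs partition the $kn$ variables into chains (the classes of variables joined by sequences of remaining arcs), and for each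 $i$ the variables $x_i,x_i+1,\dots,x_i+k-1$, regarded as the $k$ copies of $i$ in the multiset $\{1^k,\dots,n^k\}$, all lie in the same chain. Let $\sigma_n^k(R)=(a_1,\dots,a_n)$, where $a_i$ is the position $p$ in $y_1y_2\cdots y_{kn}$ of the leftmost element $y_p$ of the chain containing all copies of $i$. **Theorem.** The map $\sigma_n^k$ is a bijection from the set of regions of $\mathcal S_n^k$ to the set of $k$-parking functions on $[n]$. -/

import Mathlib

/-- The regions of a hyperplane arrangement `A` in `ℝⁿ`: the connected components of the space
obtained from `ℝⁿ` by removing all the hyperplanes of `A`. -/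
def regions {n : ℕ} (A : Set (Set (Fin n → ℝ))) : Set (Set (Fin n → ℝ)) :=
  {R | ∃ x ∈ (⋃₀ A)ᶜ, R = connectedComponentIn (⋃₀ A)ᶜ x}

/-- The extended Shi arrangement: the hyperplanes `x_i - x_j = l` for `i < j` and
`-k + 1 ≤ l ≤ k`. -/
def extendedShi (n k : ℕ) : Set (Set (Fin n → ℝ)) :=
  {H | ∃ (i j : Fin n) (l : ℤ), i < j ∧ -(k : ℤ) + 1 ≤ l ∧ l ≤ (k : ℤ) ∧
    H = {x | x i - x j = (l : ℝ)}}

/-- `f = (a_1, …, a_n)` is a `k`-parking function: its terms are positive integers and its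
increasing rearrangement `b_1 ≤ ⋯ ≤ b_n` satisfies `b_i ≤ 1 + k (i - 1)`. Indices in `Fin n`
start at `0`, so the bound for the entry with index `i : Fin n` reads `1 + k * i`. -/
def IsKParking {n : ℕ} (k : ℕ) (f : Fin n → ℕ) : Prop :=
  (∀ i, 0 < f i) ∧ ∀ i : Fin n, f (Tuple.sort f i) ≤ 1 + k * (i : ℕ)

namespace ShiDiagram

variable {n k : ℕ}

/-- The value at `x` of the variable `x_i + m`, encoded as the pair `v = (i, m)`. -/
def value (x : Fin n → ℝ) (v : Fin n × Fin k) : ℝ :=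
  x v.1 + ((v.2 : ℕ) : ℝ)

/-- `v > w` holds on `R`, that is, `v` appears to the left of `w` in the diagram of `R`. -/
def Left (R : Set (Fin n → ℝ)) (v w : Fin n × Fin k) : Prop :=
  ∀ x ∈ R, value x w < value x v

open Classical in
/-- The position (counted from the left, starting with `1`) of the variable `v` in the
permutation `y_1 y_2 ⋯ y_{kn}` of the variables such that `y_1 > y_2 > ⋯ > y_{kn}` holds on
`R`. -/
noncomputable def position (R : Set (Fin n → ℝ)) (v : Fin n × Fin k) : ℕ :=
  (Finset.univ.filter fun w : Fin n × Fin k => Left R w v).card + 1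

/-- The arcs drawn initially: from `x_i + m` to `x_i + m - 1` for `m > 0`, and from `x_i` to
`x_j + k - 1` whenever `i < j` and `x_i - x_j > k` holds on `R`. -/
def Arc (R : Set (Fin n → ℝ)) (v w : Fin n × Fin k) : Prop :=
  (v.1 = w.1 ∧ (v.2 : ℕ) = (w.2 : ℕ) + 1) ∨
  (v.1 < w.1 ∧ (v.2 : ℕ) = 0 ∧ (w.2 : ℕ) + 1 = k ∧ ∀ x ∈ R, (k : ℝ) < x v.1 - x w.1)

/-- The arcs of the diagram of `R`: those initial arcs that contain no other initial arc. The
arc `v → w` contains `v' → w'` if, from left to right, `v ≤ v'` and `w' ≤ w`. -/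
def DiagramArc (R : Set (Fin n → ℝ)) (v w : Fin n × Fin k) : Prop :=
  Arc R v w ∧ ∀ v' w' : Fin n × Fin k, Arc R v' w' →
    (v = v' ∨ Left R v v') → (w' = w ∨ Left R w' w) → v' = v ∧ w' = w

/-- `v` and `w` lie in the same chain of the diagram of `R`: they are joined by a sequence of
arcs of the diagram. -/
def SameChain (R : Set (Fin n → ℝ)) (v w : Fin n × Fin k) : Prop :=
  Relation.EqvGen (DiagramArc R) v w

end ShiDiagram

/-- The map `σ_n^k`: it sends a region `R` to `(a_1, …, a_n)`, where `a_i` is the position of the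
leftmost element of the chain that contains the copies `x_i, x_i + 1, …, x_i + k - 1` of `i`. -/
noncomputable def sigma (n k : ℕ) (R : Set (Fin n → ℝ)) (i : Fin n) : ℕ :=
  sInf {p : ℕ | ∃ (m : Fin k) (v : Fin n × Fin k),
    ShiDiagram.SameChain R (i, m) v ∧ p = ShiDiagram.position R v}

/-! A region and its image `f` share the same combinatorial core. Two labels lie in one chain
exactly when `f` agrees on them, because the leftmost position of a chain determines the chain. Arcs
run through the copies of a label and then on to a larger label, so `f` alone determines all arcs of
the diagram: they join consecutive members of each fibre of `f` (`diagramArc_iff_cov`). What remains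
is to place the variables from left to right. Nesting is forbidden, so this is a first-in-first-out
queue: at each position either a chain prescribed by `f` starts, or the earliest variable with an
unplaced successor is continued.

Hence `f` determines the order of the variables (`IsChainPosition.unique`). Order and arcs determine
the region: comparisons of variables decide the hyperplanes with `|l| < k`, and `x_i - x_j > k`
holds exactly when some arc lies between `x_i` and `x_j + k - 1` (`cell_eq_cell`). This gives
injectivity.

The parking condition says exactly that the queue never runs empty, which gives a numbering for
every parking function (`exists_isChainPosition`) and, conversely, shows that every image is a
parking function (`IsChainPosition.isKParking`). For surjectivity the numbering is realized by real
numbers chosen one at a time from left to right (`exists_real_of_nonnesting`). Arcs inside a label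
get length exactly 1 and arcs between labels length greater than 1, so the result comes from a point
of `ℝⁿ` with the required diagram (`IsChainPosition.exists_region`). -/

namespace ShiDiagram

variable {n k : ℕ}

/-! ### Chains determined by the fibres of a labelling -/

/-- The rank of a variable in the order in which the variables of a chain are met from left to
right: `x_i + k - 1, …, x_i` for increasing `i`. -/
def chainRank (v : Fin n × Fin k) : ℕ :=
  v.1 * k + (k - 1 - v.2)

theorem chainRank_lt_of_fst_lt {v w : Fin n × Fin k} (h : v.1 < w.1) :
    chainRank v < chainRank w := by
  have h1 : ((v.1 : ℕ) + 1) * k ≤ w.1 * k := Nat.mul_le_mul_right k h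
  have h2 := v.2.isLt
  unfold chainRank
  rw [Nat.add_mul] at h1
  omega

theorem chainRank_lt_iff {v w : Fin n × Fin k} :
    chainRank v < chainRank w ↔ v.1 < w.1 ∨ v.1 = w.1 ∧ w.2 < v.2 := by
  rcases lt_trichotomy v.1 w.1 with h | h | h
  · simp [chainRank_lt_of_fst_lt h, h]
  · have h1 := v.2.isLt
    have h2 := w.2.isLt
    simp only [h, lt_irrefl, false_or, true_and, chainRank, Fin.lt_def]
    omega
  · have := chainRank_lt_of_fst_lt h
    simp only [this.not_gt, h.not_gt, h.ne', false_and, or_false]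

theorem chainRank_injective : Function.Injective (chainRank : Fin n × Fin k → ℕ) := by
  intro v w h
  have h1 := mt chainRank_lt_iff.2 h.not_lt
  have h2 := mt chainRank_lt_iff.2 h.not_gt
  push Not at h1 h2
  have h3 : v.1 = w.1 := le_antisymm h2.1 h1.1
  exact Prod.ext h3 (le_antisymm (h1.2 h3) (h2.2 h3.symm))

/-- `v` and `w` are consecutive, with respect to `chainRank`, among the variables whose label has
the same value under `f`. -/
def Cov (f : Fin n → ℕ) (v w : Fin n × Fin k) : Prop :=
  f v.1 = f w.1 ∧ chainRank v < chainRank w ∧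
    ∀ u : Fin n × Fin k, f u.1 = f v.1 → chainRank u ≤ chainRank v ∨ chainRank w ≤ chainRank u

theorem Cov.right_unique {f : Fin n → ℕ} {v w w' : Fin n × Fin k} (h : Cov f v w)
    (h' : Cov f v w') : w = w' := by
  apply chainRank_injective
  have h1 := h.2.2 w' h'.1.symm
  have h2 := h'.2.2 w h.1.symm
  have h3 := h.2.1
  have h4 := h'.2.1
  omega

theorem Cov.left_unique {f : Fin n → ℕ} {v v' w : Fin n × Fin k} (h : Cov f v w)
    (h' : Cov f v' w) : v = v' := by
  apply chainRank_injective
  have h1 := h.2.2 v' (h'.1.trans h.1.symm)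
  have h2 := h'.2.2 v (h.1.trans h'.1.symm)
  have h3 := h.2.1
  have h4 := h'.2.1
  omega

theorem exists_cov_left {f : Fin n → ℕ} {v w : Fin n × Fin k} (hf : f v.1 = f w.1)
    (h : chainRank v < chainRank w) : ∃ u, Cov f u w := by
  classical
  obtain ⟨u, hu, hmax⟩ := Finset.exists_max_image
    (Finset.univ.filter fun u : Fin n × Fin k => f u.1 = f w.1 ∧ chainRank u < chainRank w)
    chainRank ⟨v, by simp [hf, h]⟩
  simp only [Finset.mem_filter, Finset.mem_univ, true_and] at hu hmax
  refine ⟨u, ⟨hu.1, hu.2, fun z hz => ?_⟩⟩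
  rcases lt_or_ge (chainRank z) (chainRank w) with h1 | h1
  · exact Or.inl (hmax z ⟨hz.trans hu.1, h1⟩)
  · exact Or.inr h1

theorem eq_of_not_cov {f : Fin n → ℕ} {v w : Fin n × Fin k} (hf : f v.1 = f w.1)
    (hv : ∀ u, ¬ Cov f u v) (hw : ∀ u, ¬ Cov f u w) : v = w := by
  apply chainRank_injective
  rcases lt_trichotomy (chainRank v) (chainRank w) with h | h | h
  · obtain ⟨u, hu⟩ := exists_cov_left hf h
    exact (hw u hu).elim
  · exact h
  · obtain ⟨u, hu⟩ := exists_cov_left hf.symm h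
    exact (hv u hu).elim

/-- Induction along the chains of `f`, starting from their first elements. -/
theorem cov_induction {f : Fin n → ℕ} {P : Fin n × Fin k → Prop}
    (start : ∀ v, (∀ u, ¬ Cov f u v) → P v) (step : ∀ u v, Cov f u v → P u → P v)
    (v : Fin n × Fin k) : P v := by
  induction h : chainRank v using Nat.strong_induction_on generalizing v with
  | _ r ih =>
    by_cases hv : ∃ u, Cov f u v
    · obtain ⟨u, hu⟩ := hv
      exact step u v hu (ih _ (h ▸ hu.2.1) u rfl)
    · exact start v (not_exists.1 hv)

theorem exists_start (f : Fin n → ℕ) (v : Fin n × Fin k) :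
    ∃ u : Fin n × Fin k, f u.1 = f v.1 ∧ ∀ w, ¬ Cov f w u := by
  induction v using cov_induction (f := f) with
  | start v hv => exact ⟨v, rfl, hv⟩
  | step u v huv ih =>
    obtain ⟨w, hw, hw'⟩ := ih
    exact ⟨w, hw.trans huv.1, hw'⟩

/-- All `k` copies of a label have the same value under `f` and occupy consecutive ranks, so a chain
can leave a label only at its last copy and enter the next label only at its first. -/
theorem Cov.cases {f : Fin n → ℕ} {v w : Fin n × Fin k} (h : Cov f v w) :
    (v.1 = w.1 ∧ (v.2 : ℕ) = (w.2 : ℕ) + 1) ∨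
      (v.1 < w.1 ∧ (v.2 : ℕ) = 0 ∧ (w.2 : ℕ) + 1 = k) := by
  obtain ⟨hf, hlt, hno⟩ := h
  have hv := v.2.isLt
  have hw := w.2.isLt
  rcases chainRank_lt_iff.1 hlt with h1 | ⟨h1, h2⟩
  · refine Or.inr ⟨h1, ?_, ?_⟩
    · by_contra h0
      have := hno (v.1, ⟨v.2 - 1, by omega⟩) rfl
      simp only [← not_lt, chainRank_lt_iff, Fin.lt_def] at this h1
      simp only [true_and] at this
      omega
    · by_contra h0
      have := hno (w.1, ⟨w.2 + 1, by omega⟩) hf.symm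
      simp only [← not_lt, chainRank_lt_iff, Fin.lt_def] at this h1
      simp only [true_and] at this
      omega
  · refine Or.inl ⟨h1, ?_⟩
    by_contra h0
    have h2' := Fin.lt_def.1 h2
    have := hno (v.1, ⟨v.2 - 1, by omega⟩) rfl
    simp only [← not_lt, chainRank_lt_iff, Fin.lt_def, h1] at this
    simp only [true_and] at this
    omega

theorem cov_of_eq_add_one (f : Fin n → ℕ) {v w : Fin n × Fin k} (h1 : v.1 = w.1)
    (h2 : (v.2 : ℕ) = (w.2 : ℕ) + 1) : Cov f v w := by
  have hv := v.2.isLt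
  refine ⟨by rw [h1], chainRank_lt_iff.2 (Or.inr ⟨h1, Fin.lt_def.2 (by omega)⟩), fun u _ => ?_⟩
  simp only [← not_lt, chainRank_lt_iff, h1, Fin.lt_def]
  by_cases h : u.1 = w.1
  · simp only [h]; omega
  · omega

/-! ### Uniqueness of the numbering -/

/-- `pos` numbers the variables from `1` to `n * k` in such a way that the arcs between
consecutive variables of the chains of `f` point to the right and do not nest, and the first
element of each chain has the number prescribed by `f`. -/
structure IsChainPosition (f : Fin n → ℕ) (pos : Fin n × Fin k → ℕ) : Prop where
  inj : Function.Injective pos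
  one_le : ∀ v, 1 ≤ pos v
  le : ∀ v, pos v ≤ n * k
  lt : ∀ {v w}, Cov f v w → pos v < pos w
  nonnesting : ∀ {v w v' w'}, Cov f v w → Cov f v' w' → pos v < pos v' → pos w < pos w'
  start : ∀ v, (∀ u, ¬ Cov f u v) → pos v = f v.1

namespace IsChainPosition

variable {f : Fin n → ℕ} {pos pos' : Fin n × Fin k → ℕ}

theorem image_eq (h : IsChainPosition f pos) :
    Finset.univ.image pos = Finset.Icc 1 (n * k) := by
  apply Finset.eq_of_subset_of_card_le
  · intro p hp
    obtain ⟨v, -, rfl⟩ := Finset.mem_image.1 hp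
    exact Finset.mem_Icc.2 ⟨h.one_le v, h.le v⟩
  · rw [Finset.card_image_of_injective _ h.inj]
    simp

theorem exists_eq (h : IsChainPosition f pos) {p : ℕ} (h1 : 1 ≤ p) (h2 : p ≤ n * k) :
    ∃ v, pos v = p := by
  have : p ∈ Finset.univ.image pos := by
    rw [h.image_eq]
    exact Finset.mem_Icc.2 ⟨h1, h2⟩
  simpa using this

theorem card_lt (h : IsChainPosition f pos) (v : Fin n × Fin k) :
    (Finset.univ.filter fun w => pos w < pos v).card + 1 = pos v := by
  have h1 : (Finset.univ.filter fun w => pos w < pos v).image pos = Finset.Ico 1 (pos v) := by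
    ext p
    simp only [Finset.mem_image, Finset.mem_filter, Finset.mem_univ, true_and, Finset.mem_Ico]
    constructor
    · rintro ⟨w, hw, rfl⟩
      exact ⟨h.one_le w, hw⟩
    · rintro ⟨hp, hp'⟩
      obtain ⟨w, rfl⟩ := h.exists_eq hp (hp'.le.trans (h.le v))
      exact ⟨w, hp', rfl⟩
  rw [← Finset.card_image_of_injective _ h.inj, h1, Nat.card_Ico]
  have := h.one_le v
  omega

theorem unique (h : IsChainPosition f pos) (h' : IsChainPosition f pos') : pos = pos' := by
  suffices H : ∀ p v, pos v = p → pos' v = p from funext fun v => (H _ v rfl).symm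
  intro p
  induction p using Nat.strong_induction_on with
  | _ p ih =>
    intro v hv
    -- The induction hypothesis also works from `pos'` to `pos`: by surjectivity and injectivity,
    -- both numberings put the same variable at each position below `p`.
    have ih' : ∀ u, pos' u < p → pos u = pos' u := by
      intro u hu
      obtain ⟨z, hz⟩ := h.exists_eq (h'.one_le u) (h'.le u)
      have := ih _ hu z hz
      rw [← h'.inj this, hz, this]
    obtain ⟨w, hw⟩ := h'.exists_eq (hv ▸ h.one_le v) (hv ▸ h.le v)
    by_cases hsv : ∃ u, Cov f u v
    · by_cases hsw : ∃ u, Cov f u w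
      · obtain ⟨u, hu⟩ := hsv
        obtain ⟨u', hu'⟩ := hsw
        have a1 : pos u < p := hv ▸ h.lt hu
        have a2 : pos' u' < p := hw ▸ h'.lt hu'
        have a3 := ih _ a1 u rfl
        have a4 := ih' u' a2
        -- Of the two candidates for position `p`, the one with the earlier predecessor must come
        -- first in both numberings; the other numbering would then have placed it before `p`.
        rcases lt_trichotomy (pos u) (pos u') with hlt | heq | hlt
        · have b := h'.nonnesting hu hu' (by omega)
          have c := ih' v (by omega)
          omega
        · obtain rfl := h.inj heq
          rwa [hu.right_unique hu']
        · have b := h.nonnesting hu' hu hlt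
          have c := ih _ (hv ▸ b) w rfl
          omega
      · have a := h.start w (not_exists.1 hsw)
        rw [← h'.start w (not_exists.1 hsw), hw, ← hv] at a
        rwa [← h.inj a]
    · rw [h'.start v (not_exists.1 hsv), ← h.start v (not_exists.1 hsv), hv]

end IsChainPosition

/-! ### Existence of the numbering: filling positions from left to right -/

/-- A numbering of some of the variables by `1, …, p`, the value `0` standing for a variable
without a number, that satisfies the conditions of `IsChainPosition` as far as it goes. -/
structure IsPartialPosition (f : Fin n → ℕ) (p : ℕ) (pos : Fin n × Fin k → ℕ) : Prop where
  le : ∀ v, pos v ≤ p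
  inj : ∀ {v w}, pos v ≠ 0 → pos v = pos w → v = w
  exists_eq : ∀ q, 1 ≤ q → q ≤ p → ∃ v, pos v = q
  lt : ∀ {v w}, Cov f v w → pos w ≠ 0 → pos v ≠ 0 ∧ pos v < pos w
  start : ∀ v, (∀ u, ¬ Cov f u v) → pos v ≠ 0 → pos v = f v.1
  start_ne : ∀ v, (∀ u, ¬ Cov f u v) → f v.1 ≤ p → pos v ≠ 0
  nonnesting : ∀ {v w v' w'}, Cov f v w → Cov f v' w' → pos v ≠ 0 → pos v < pos v' →
    pos w' ≠ 0 → pos w ≠ 0 ∧ pos w < pos w'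

namespace IsPartialPosition

variable {f : Fin n → ℕ} {p : ℕ} {pos : Fin n × Fin k → ℕ}

theorem update [DecidableEq (Fin n × Fin k)] (h : IsPartialPosition f p pos) {v : Fin n × Fin k}
    (hv : pos v = 0)
    (hstart : (∀ u, ¬ Cov f u v) → f v.1 = p + 1)
    (hcov : ∀ u, Cov f u v → pos u ≠ 0 ∧
      ∀ u' w', Cov f u' w' → pos u' ≠ 0 → pos u' < pos u → pos w' ≠ 0)
    (hother : ∀ w : Fin n × Fin k, (∀ u, ¬ Cov f u w) → f w.1 = p + 1 → w = v) :
    IsPartialPosition f (p + 1) (Function.update pos v (p + 1)) := by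
  have same : Function.update pos v (p + 1) v = p + 1 := Function.update_self ..
  have diff : ∀ w, w ≠ v → Function.update pos v (p + 1) w = pos w := fun w hw =>
    Function.update_of_ne hw ..
  have nosucc : ∀ w, Cov f v w → pos w = 0 := fun w hw => by
    by_contra h0
    exact (h.lt hw h0).1 hv
  refine ⟨?_, ?_, ?_, ?_, ?_, ?_, ?_⟩
  · intro w
    by_cases hw : w = v
    · rw [hw, same]
    · rw [diff w hw]; exact (h.le w).trans (Nat.le_succ p)
  · intro a b h0 hab
    by_cases ha : a = v <;> by_cases hb : b = v
    · rw [ha, hb]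
    · rw [ha, same, diff b hb] at hab
      have := h.le b
      omega
    · rw [hb, same, diff a ha] at hab
      have := h.le a
      omega
    · rw [diff a ha] at h0 hab
      rw [diff b hb] at hab
      exact h.inj h0 hab
  · intro q h1 h2
    rcases h2.lt_or_eq with h3 | rfl
    · obtain ⟨w, hw⟩ := h.exists_eq q h1 (by omega)
      refine ⟨w, ?_⟩
      rw [diff w (by rintro rfl; omega), hw]
    · exact ⟨v, same⟩
  · intro a b hab hb
    by_cases hbv : b = v
    · subst hbv
      have hav : a ≠ b := by rintro rfl; exact hab.2.1.ne rfl
      rw [diff a hav, same]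
      have := h.le a
      exact ⟨(hcov a hab).1, by omega⟩
    · rw [diff b hbv] at hb ⊢
      by_cases hav : a = v
      · subst hav; exact (hb (nosucc b hab)).elim
      · rw [diff a hav]; exact h.lt hab hb
  · intro a ha ha0
    by_cases hav : a = v
    · subst hav; rw [same, hstart ha]
    · rw [diff a hav] at ha0 ⊢; exact h.start a ha ha0
  · intro a ha hap
    by_cases hav : a = v
    · subst hav; rw [same]; omega
    · rw [diff a hav]
      refine h.start_ne a ha ?_
      by_contra hlt
      exact hav (hother a ha (by omega))
  · intro a b a' b' hab hab' ha hlt hb'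
    by_cases hav : a = v
    · subst hav
      rw [same] at hlt
      by_cases h' : a' = a
      · rw [h', same] at hlt; omega
      · rw [diff a' h'] at hlt
        have := h.le a'
        omega
    rw [diff a hav] at ha hlt
    by_cases ha'v : a' = v
    · subst ha'v
      have : b' ≠ a' := by rintro rfl; exact hab'.2.1.ne rfl
      rw [diff b' this] at hb'
      exact (hb' (nosucc b' hab')).elim
    rw [diff a' ha'v] at hlt
    by_cases hb'v : b' = v
    · subst hb'v
      have h1 := (hcov a' hab').2 a b hab ha hlt
      have h2 : b ≠ b' := by rintro rfl; exact h1 hv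
      have := h.le b
      rw [diff b h2, same]
      exact ⟨h1, by omega⟩
    rw [diff b' hb'v] at hb' ⊢
    have h1 := h.nonnesting hab hab' ha hlt hb'
    rwa [diff b (by rintro rfl; exact h1.1 hv)]

theorem card_ne_zero (h : IsPartialPosition f p pos) :
    (Finset.univ.filter fun v => pos v ≠ 0).card = p := by
  have h1 : (Finset.univ.filter fun v => pos v ≠ 0).image pos = Finset.Icc 1 p := by
    ext q
    simp only [Finset.mem_image, Finset.mem_filter, Finset.mem_univ, true_and, Finset.mem_Icc]
    constructor
    · rintro ⟨v, hv, rfl⟩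
      exact ⟨Nat.pos_of_ne_zero hv, h.le v⟩
    · rintro ⟨hq, hq'⟩
      obtain ⟨v, rfl⟩ := h.exists_eq q hq hq'
      exact ⟨v, by omega, rfl⟩
  have h2 : Set.InjOn pos (Finset.univ.filter fun v => pos v ≠ 0 : Finset (Fin n × Fin k)) := by
    intro v hv w _ hvw
    exact h.inj (by simpa using hv) hvw
  rw [← Finset.card_image_of_injOn h2, h1, Nat.card_Icc, Nat.add_sub_cancel]

/-- If no arc leaves the set of numbered variables, this set is a union of chains. -/
theorem ne_zero_iff (h : IsPartialPosition f p pos)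
    (hclosed : ∀ u v, Cov f u v → pos u ≠ 0 → pos v ≠ 0) (v : Fin n × Fin k) :
    pos v ≠ 0 ↔ f v.1 ≤ p := by
  induction v using cov_induction (f := f) with
  | start v hv => exact ⟨fun h0 => h.start v hv h0 ▸ h.le v, h.start_ne v hv⟩
  | step u v huv ih =>
    rw [← huv.1, ← ih]
    exact ⟨fun h0 => (h.lt huv h0).1, hclosed u v huv⟩

/-- The queue step. The number `p + 1` goes to the first element of a chain prescribed to start
there, and otherwise to the successor of the earliest variable whose successor is still unnumbered.
The parking bound excludes that neither exists. -/
theorem exists_succ (h : IsPartialPosition f p pos) (hp : p < n * k)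
    (hf : ∀ j < n, j + 1 ≤ (Finset.univ.filter fun i => f i ≤ 1 + k * j).card) :
    ∃ pos' : Fin n × Fin k → ℕ, IsPartialPosition f (p + 1) pos' := by
  classical
  have hk : 0 < k := Nat.pos_of_ne_zero (by rintro rfl; simp at hp)
  by_cases hs : ∃ v : Fin n × Fin k, (∀ u, ¬ Cov f u v) ∧ f v.1 = p + 1
  · obtain ⟨v, hv, hvp⟩ := hs
    refine ⟨_, h.update (v := v) ?_ (fun _ => hvp) (fun u hu => (hv u hu).elim)
      fun w hw hwp => eq_of_not_cov (hwp.trans hvp.symm) hw hv⟩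
    by_contra h0
    have h1 := h.start v hv h0
    have h2 := h.le v
    omega
  · have hno : ∀ i, f i ≠ p + 1 := by
      intro i hi
      obtain ⟨u, hu, hu'⟩ := exists_start f ((i, ⟨0, hk⟩) : Fin n × Fin k)
      exact hs ⟨u, hu', hu.trans hi⟩
    by_cases hclosed : ∀ u v, Cov f u v → pos u ≠ 0 → pos v ≠ 0
    · exfalso
      have hcard := h.card_ne_zero
      simp only [h.ne_zero_iff hclosed] at hcard
      have hprod : (Finset.univ.filter fun v : Fin n × Fin k => f v.1 ≤ p) =
          (Finset.univ.filter fun i => f i ≤ p) ×ˢ Finset.univ := by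
        ext v; simp
      rw [hprod, Finset.card_product, Finset.card_univ, Fintype.card_fin] at hcard
      -- The numbered variables are whole chains, so `p = k * j` with `j` the number of labels with
      -- `f i ≤ p`. The parking bound at `j` yields `j + 1` labels with `f i ≤ p + 1`, although no
      -- label has the value `p + 1`.
      have hc := hf _ (lt_of_mul_lt_mul_right (hcard.trans_lt hp) (Nat.zero_le k))
      rw [mul_comm k, hcard] at hc
      have hsub : (Finset.univ.filter fun i => f i ≤ 1 + p) ⊆
          Finset.univ.filter fun i => f i ≤ p := by
        intro i
        have := hno i
        simp only [Finset.mem_filter, Finset.mem_univ, true_and]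
        omega
      have := Finset.card_le_card hsub
      omega
    · push Not at hclosed
      obtain ⟨u₀, v₀, hc₀, hu₀, hv₀⟩ := hclosed
      obtain ⟨u, hu, hmin⟩ := Finset.exists_min_image
        (Finset.univ.filter fun u => pos u ≠ 0 ∧ ∃ v, Cov f u v ∧ pos v = 0) pos
        ⟨u₀, Finset.mem_filter.2 ⟨Finset.mem_univ _, hu₀, v₀, hc₀, hv₀⟩⟩
      simp only [Finset.mem_filter, Finset.mem_univ, true_and] at hu hmin
      obtain ⟨hu0, v, huv, hv0⟩ := hu
      refine ⟨_, h.update hv0 (fun hv => (hv u huv).elim) (fun u' hu' => ?_)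
        fun w hw hwp => (hs ⟨w, hw, hwp⟩).elim⟩
      obtain rfl := huv.left_unique hu'
      refine ⟨hu0, fun a b hab ha hlt hb => ?_⟩
      have := hmin a ⟨ha, b, hab, hb⟩
      omega

end IsPartialPosition

theorem exists_isChainPosition {f : Fin n → ℕ} (hpos : ∀ i, 0 < f i)
    (hf : ∀ j < n, j + 1 ≤ (Finset.univ.filter fun i => f i ≤ 1 + k * j).card) :
    ∃ pos : Fin n × Fin k → ℕ, IsChainPosition f pos := by
  have H : ∀ p ≤ n * k, ∃ pos : Fin n × Fin k → ℕ, IsPartialPosition f p pos := by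
    intro p
    induction p with
    | zero =>
      refine fun _ => ⟨fun _ => 0, ⟨by simp, by simp, fun q h1 h2 => by omega, by simp, by simp,
        fun v _ hv => ?_, by simp⟩⟩
      have := hpos v.1
      omega
    | succ p ih =>
      intro hp
      obtain ⟨pos, h⟩ := ih (by omega)
      exact h.exists_succ (by omega) hf
  obtain ⟨pos, h⟩ := H _ le_rfl
  have hall : ∀ v, pos v ≠ 0 := by
    have h1 := h.card_ne_zero
    have h2 : (Finset.univ.filter fun v => pos v ≠ 0) = Finset.univ := by
      rw [← Finset.card_eq_iff_eq_univ, h1]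
      simp
    intro v
    simpa using Finset.ext_iff.1 h2 v
  exact ⟨pos, ⟨fun v w hvw => h.inj (hall v) hvw, fun v => Nat.pos_of_ne_zero (hall v), h.le,
    fun hc => (h.lt hc (hall _)).2,
    fun hc hc' hlt => (h.nonnesting hc hc' (hall _) hlt (hall _)).2,
    fun v hv => h.start v hv (hall v)⟩⟩

end ShiDiagram

/-! ### Realizing nonnesting arcs by real numbers -/

/-- Nonnesting arcs `E` between positions `1, …, M` are realized by a decreasing sequence of real
numbers: two terms differ by at least `1` if and only if an arc lies between their positions, and
the ends of an arc differ by exactly `1` unless the arc belongs to `S`. -/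
theorem exists_real_of_nonnesting {E : ℕ → ℕ → Prop} (S : ℕ → ℕ → Prop)
    (hright : ∀ {p q q'}, E p q → E p q' → q = q')
    (hmono : ∀ {p q p' q'}, E p q → E p' q' → p < p' → q < q') (M : ℕ) :
    ∃ y : ℕ → ℝ, ∀ p q, p < q → q ≤ M →
      y q < y p ∧ ((∃ p' q', E p' q' ∧ p ≤ p' ∧ q' ≤ q) → y q ≤ y p - 1) ∧
      ((¬ ∃ p' q', E p' q' ∧ p ≤ p' ∧ q' ≤ q) → y p - 1 < y q) ∧
      (E p q → S p q → y q < y p - 1) ∧ (E p q → ¬ S p q → y q = y p - 1) := by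
  classical
  induction M with
  | zero => exact ⟨fun _ => 0, fun p q h1 h2 => by omega⟩
  | succ M ih =>
    obtain ⟨y, hy⟩ := ih
    have hleft : ∀ {p p' q}, E p q → E p' q → p = p' := by
      intro p p' q h h'
      rcases lt_trichotomy p p' with hlt | heq | hlt
      · exact (hmono h h' hlt).false.elim
      · exact heq
      · exact (hmono h' h hlt).false.elim
    have hanti : ∀ p q, p ≤ q → q ≤ M → y q ≤ y p := by
      intro p q hpq hq
      rcases hpq.eq_or_lt with rfl | h
      · exact le_rfl
      · exact (hy p q h hq).1.le
    suffices H : ∃ z : ℝ, ∀ p ≤ M, z < y p ∧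
        ((∃ p' q', E p' q' ∧ p ≤ p' ∧ q' ≤ M + 1) → z ≤ y p - 1) ∧
        ((¬ ∃ p' q', E p' q' ∧ p ≤ p' ∧ q' ≤ M + 1) → y p - 1 < z) ∧
        (E p (M + 1) → S p (M + 1) → z < y p - 1) ∧
        (E p (M + 1) → ¬ S p (M + 1) → z = y p - 1) by
      obtain ⟨z, hz⟩ := H
      refine ⟨Function.update y (M + 1) z, fun p q hpq hq => ?_⟩
      rw [Function.update_of_ne (show p ≠ M + 1 by omega)]
      rcases hq.eq_or_lt with rfl | hq
      · rw [Function.update_self]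
        exact hz p (by omega)
      · rw [Function.update_of_ne hq.ne]
        exact hy p q hpq (by omega)
    -- A nonstrict arc ending at `M + 1` forces the new term. Otherwise finitely many strict bounds
    -- have to be met, and each lower bound lies below each upper bound.
    by_cases hr : ∃ r ≤ M, E r (M + 1) ∧ ¬ S r (M + 1)
    · obtain ⟨r, hrM, hr, hrS⟩ := hr
      have hle : ∀ p, (∃ p' q', E p' q' ∧ p ≤ p' ∧ q' ≤ M + 1) → p ≤ r := by
        rintro p ⟨p', q', hE, h1, h2⟩
        by_contra h3
        have := hmono hr hE (by omega)
        omega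
      refine ⟨y r - 1, fun p hp => ⟨?_, ?_, ?_, ?_, ?_⟩⟩
      · rcases le_or_gt p r with h | h
        · linarith [hanti p r h hrM]
        · refine (hy r p h hp).2.2.1 ?_
          rintro ⟨p', q', hE, h1, h2⟩
          rcases h1.eq_or_lt with rfl | h1
          · have := hright hE hr
            omega
          · have := hmono hr hE h1
            omega
      · intro hC
        linarith [hanti p r (hle p hC) hrM]
      · intro hC
        have : r < p := by
          by_contra h
          exact hC ⟨r, M + 1, hr, by omega, le_rfl⟩
        linarith [(hy r p this hp).1]
      · intro hE hS
        rw [hleft hE hr] at hS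
        exact (hrS hS).elim
      · intro hE _
        rw [hleft hE hr]
    · have hr' : ∀ p ≤ M, E p (M + 1) → S p (M + 1) := by
        intro p hp hE
        by_contra hS
        exact hr ⟨p, hp, hE, hS⟩
      obtain ⟨z, hlo, hhi⟩ := Order.exists_between_finsets
        (((Finset.range (M + 1)).filter fun p =>
          ¬ ∃ p' q', E p' q' ∧ p ≤ p' ∧ q' ≤ M + 1).image fun p => y p - 1)
        ((Finset.range (M + 1)).image y ∪ ((Finset.range (M + 1)).filter fun p =>
          ∃ p' q', E p' q' ∧ p ≤ p' ∧ q' ≤ M + 1).image fun p => y p - 1) (by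
        intro a ha b hb
        simp only [Finset.mem_image, Finset.mem_filter, Finset.mem_range, Finset.mem_union]
          at ha hb
        obtain ⟨p, ⟨hp, hC⟩, rfl⟩ := ha
        rcases hb with ⟨q, hq, rfl⟩ | ⟨q, ⟨hq, hC'⟩, rfl⟩
        · rcases le_or_gt q p with h | h
          · linarith [hanti q p h (by omega)]
          · refine (hy p q h (by omega)).2.2.1 ?_
            rintro ⟨p', q', hE, h1, h2⟩
            exact hC ⟨p', q', hE, h1, by omega⟩
        · obtain ⟨p', q', hE, h1, h2⟩ := hC'
          have : q < p := by
            by_contra h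
            exact hC ⟨p', q', hE, by omega, h2⟩
          linarith [(hy q p this (by omega)).1])
      simp only [Finset.mem_image, Finset.mem_filter, Finset.mem_range, Finset.mem_union] at hlo hhi
      have hup : ∀ p ≤ M, (∃ p' q', E p' q' ∧ p ≤ p' ∧ q' ≤ M + 1) → z < y p - 1 := fun p hp hC =>
        hhi _ (Or.inr ⟨p, ⟨by omega, hC⟩, rfl⟩)
      exact ⟨z, fun p hp => ⟨hhi _ (Or.inl ⟨p, by omega, rfl⟩), fun hC => (hup p hp hC).le,
        fun hC => hlo _ ⟨p, ⟨by omega, hC⟩, rfl⟩,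
        fun hE _ => hup p hp ⟨p, M + 1, hE, le_rfl, le_rfl⟩,
        fun hE hS => (hS (hr' p hp hE)).elim⟩⟩

/-! ### Regions as sign cells -/

namespace ShiDiagram

variable {n k : ℕ}

/-- `x` lies on no hyperplane of the extended Shi arrangement. -/
def IsGeneric (k : ℕ) (x : Fin n → ℝ) : Prop :=
  ∀ i j : Fin n, i < j → ∀ l : ℤ, -(k : ℤ) + 1 ≤ l → l ≤ k → x i - x j ≠ l

theorem mem_compl_sUnion_iff {x : Fin n → ℝ} :
    x ∈ (⋃₀ extendedShi n k)ᶜ ↔ IsGeneric k x := by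
  simp only [Set.mem_compl_iff, Set.mem_sUnion, extendedShi, IsGeneric]
  constructor
  · intro h i j hij l h1 h2 hx
    exact h ⟨_, ⟨i, j, l, hij, h1, h2, rfl⟩, hx⟩
  · rintro h ⟨_, ⟨i, j, l, hij, h1, h2, rfl⟩, hx⟩
    exact h i j hij l h1 h2 hx

/-- The points on the same side as `x` of all hyperplanes of the extended Shi arrangement. -/
def cell (k : ℕ) (x : Fin n → ℝ) : Set (Fin n → ℝ) :=
  {y | ∀ i j : Fin n, i < j → ∀ l : ℤ, -(k : ℤ) + 1 ≤ l → l ≤ k →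
    (x i - x j < l → y i - y j < l) ∧ (l < x i - x j → l < y i - y j)}

theorem mem_cell_self (x : Fin n → ℝ) : x ∈ cell k x :=
  fun _ _ _ _ _ _ => ⟨id, id⟩

theorem IsGeneric.of_mem_cell {x y : Fin n → ℝ} (hx : IsGeneric k x) (hy : y ∈ cell k x) :
    IsGeneric k y := by
  intro i j hij l h1 h2
  rcases (hx i j hij l h1 h2).lt_or_gt with h | h
  · exact ((hy i j hij l h1 h2).1 h).ne
  · exact ((hy i j hij l h1 h2).2 h).ne'

theorem convex_cell (x : Fin n → ℝ) : Convex ℝ (cell k x) := by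
  intro y hy z hz a b ha hb hab i j hij l h1 h2
  have e : (a • y + b • z) i - (a • y + b • z) j = a • (y i - y j) + b • (z i - z j) := by
    simp only [Pi.add_apply, Pi.smul_apply, smul_eq_mul]
    ring
  rw [e]
  exact ⟨fun h => convex_Iio (l : ℝ) ((hy i j hij l h1 h2).1 h) ((hz i j hij l h1 h2).1 h)
    ha hb hab, fun h => convex_Ioi (l : ℝ) ((hy i j hij l h1 h2).2 h) ((hz i j hij l h1 h2).2 h)
    ha hb hab⟩

/-- By the intermediate value theorem no difference of coordinates crosses a forbidden value inside
the component; conversely, the cell is convex, hence connected. -/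
theorem connectedComponentIn_eq_cell {x : Fin n → ℝ} (hx : IsGeneric k x) :
    connectedComponentIn (⋃₀ extendedShi n k)ᶜ x = cell k x := by
  apply Set.Subset.antisymm
  · intro y hy i j hij l h1 h2
    have hpre := isPreconnected_connectedComponentIn (x := x) (F := (⋃₀ extendedShi n k)ᶜ)
    have hxm := mem_connectedComponentIn (mem_compl_sUnion_iff.2 hx)
    have hcont : Continuous fun z : Fin n → ℝ => z i - z j := by fun_prop
    have hne : ∀ z ∈ connectedComponentIn (⋃₀ extendedShi n k)ᶜ x, z i - z j ≠ l := fun z hz =>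
      mem_compl_sUnion_iff.1 (connectedComponentIn_subset _ _ hz) i j hij l h1 h2
    constructor <;> intro h <;> by_contra h'
    · obtain ⟨z, hz, hzl⟩ := hpre.intermediate_value hxm hy hcont.continuousOn
        ⟨h.le, not_lt.1 h'⟩
      exact hne z hz hzl
    · obtain ⟨z, hz, hzl⟩ := hpre.intermediate_value hy hxm hcont.continuousOn
        ⟨not_lt.1 h', h.le⟩
      exact hne z hz hzl
  · exact (convex_cell x).isPreconnected.subset_connectedComponentIn (mem_cell_self x)
      fun y hy => mem_compl_sUnion_iff.2 (hx.of_mem_cell hy)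

theorem mem_regions_iff {R : Set (Fin n → ℝ)} :
    R ∈ regions (extendedShi n k) ↔ ∃ x, IsGeneric k x ∧ R = cell k x := by
  constructor
  · rintro ⟨x, hx, rfl⟩
    exact ⟨x, mem_compl_sUnion_iff.1 hx, connectedComponentIn_eq_cell (mem_compl_sUnion_iff.1 hx)⟩
  · rintro ⟨x, hx, rfl⟩
    exact ⟨x, mem_compl_sUnion_iff.2 hx, (connectedComponentIn_eq_cell hx).symm⟩

theorem cell_eq_of_mem {x y : Fin n → ℝ} (hx : IsGeneric k x) (hy : y ∈ cell k x) :
    cell k x = cell k y := by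
  rw [← connectedComponentIn_eq_cell hx] at hy ⊢
  rw [connectedComponentIn_eq hy, connectedComponentIn_eq_cell]
  exact mem_compl_sUnion_iff.1 (connectedComponentIn_subset _ _ hy)

/-! ### The diagram of a generic point -/

section Generic

variable {x : Fin n → ℝ}

/-- Comparing copies of two distinct labels means choosing a side of a hyperplane with `|l| ≤ k -
1`, so one point of the cell decides it. -/
theorem left_cell_iff {v w : Fin n × Fin k} :
    Left (cell k x) v w ↔ value x w < value x v := by
  refine ⟨fun h => h x (mem_cell_self x), fun h y hy => ?_⟩
  have hv := v.2.isLt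
  have hw := w.2.isLt
  unfold value at h ⊢
  rcases lt_trichotomy v.1 w.1 with hlt | heq | hlt
  · have := (hy v.1 w.1 hlt (((w.2 : ℕ) : ℤ) - ((v.2 : ℕ) : ℤ)) (by omega) (by omega)).2
      (by push_cast; linarith)
    push_cast at this
    linarith
  · rw [heq] at h ⊢
    linarith
  · have := (hy w.1 v.1 hlt (((v.2 : ℕ) : ℤ) - ((w.2 : ℕ) : ℤ)) (by omega) (by omega)).1
      (by push_cast; linarith)
    push_cast at this
    linarith

theorem arc_cell_iff {v w : Fin n × Fin k} :
    Arc (cell k x) v w ↔ (v.1 = w.1 ∧ (v.2 : ℕ) = (w.2 : ℕ) + 1) ∨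
      (v.1 < w.1 ∧ (v.2 : ℕ) = 0 ∧ (w.2 : ℕ) + 1 = k ∧ (k : ℝ) < x v.1 - x w.1) := by
  unfold Arc
  refine or_congr_right (and_congr_right fun hlt => and_congr_right fun _ =>
    and_congr_right fun _ => ⟨fun h => h x (mem_cell_self x), fun h y hy => ?_⟩)
  exact_mod_cast (hy v.1 w.1 hlt k (by omega) le_rfl).2 (by exact_mod_cast h)

theorem value_injective (hx : IsGeneric k x) :
    Function.Injective (value x : Fin n × Fin k → ℝ) := by
  intro v w h
  have hv := v.2.isLt
  have hw := w.2.isLt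
  unfold value at h
  rcases lt_trichotomy v.1 w.1 with hlt | heq | hlt
  · refine (hx v.1 w.1 hlt (((w.2 : ℕ) : ℤ) - ((v.2 : ℕ) : ℤ)) (by omega) (by omega) ?_).elim
    push_cast
    linarith
  · rw [heq] at h
    exact Prod.ext heq (Fin.ext (by exact_mod_cast add_left_cancel h))
  · refine (hx w.1 v.1 hlt (((v.2 : ℕ) : ℤ) - ((w.2 : ℕ) : ℤ)) (by omega) (by omega) ?_).elim
    push_cast
    linarith

theorem eq_or_left_cell_iff (hx : IsGeneric k x) {v w : Fin n × Fin k} :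
    (v = w ∨ Left (cell k x) v w) ↔ value x w ≤ value x v := by
  rw [left_cell_iff, le_iff_eq_or_lt, (value_injective hx).eq_iff, eq_comm]

theorem diagramArc_cell_iff (hx : IsGeneric k x) {v w : Fin n × Fin k} :
    DiagramArc (cell k x) v w ↔ Arc (cell k x) v w ∧ ∀ v' w', Arc (cell k x) v' w' →
      value x v' ≤ value x v → value x w ≤ value x w' → v' = v ∧ w' = w := by
  simp only [DiagramArc, eq_or_left_cell_iff hx]

theorem position_lt_of_value_lt {v w : Fin n × Fin k} (h : value x w < value x v) :
    position (cell k x) v < position (cell k x) w := by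
  classical
  unfold position
  simp only [left_cell_iff]
  refine Nat.add_lt_add_right (Finset.card_lt_card ?_) 1
  rw [Finset.ssubset_iff_of_subset]
  · exact ⟨v, by simpa using h, by simp⟩
  · intro u
    simp only [Finset.mem_filter, Finset.mem_univ, true_and]
    exact h.trans

theorem position_lt_iff (hx : IsGeneric k x) {v w : Fin n × Fin k} :
    position (cell k x) v < position (cell k x) w ↔ value x w < value x v := by
  refine ⟨fun h => ?_, position_lt_of_value_lt⟩
  rcases lt_trichotomy (value x w) (value x v) with h1 | h1 | h1
  · exact h1
  · rw [value_injective hx h1] at h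
    exact h.false.elim
  · exact (h.not_gt (position_lt_of_value_lt h1)).elim

theorem position_le_iff (hx : IsGeneric k x) {v w : Fin n × Fin k} :
    position (cell k x) v ≤ position (cell k x) w ↔ value x w ≤ value x v := by
  rw [← not_lt, position_lt_iff hx, not_lt]

theorem position_injective (hx : IsGeneric k x) :
    Function.Injective (position (cell k x) : Fin n × Fin k → ℕ) := fun _ _ h =>
  value_injective hx (le_antisymm ((position_le_iff hx).1 h.ge) ((position_le_iff hx).1 h.le))

theorem position_le (R : Set (Fin n → ℝ)) (hR : R.Nonempty) (v : Fin n × Fin k) :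
    position R v ≤ n * k := by
  classical
  unfold position
  rw [Nat.add_one_le_iff]
  have : n * k = (Finset.univ : Finset (Fin n × Fin k)).card := by simp
  rw [this]
  refine Finset.card_lt_card ((Finset.ssubset_iff_of_subset (Finset.subset_univ _)).2
    ⟨v, Finset.mem_univ v, ?_⟩)
  obtain ⟨x, hx⟩ := hR
  simp only [Finset.mem_filter, Finset.mem_univ, true_and]
  exact fun h => (h x hx).false

theorem value_of_arc {v w : Fin n × Fin k} (h : Arc (cell k x) v w) :
    value x w + 1 ≤ value x v ∧ (v.1 ≠ w.1 → value x w + 1 < value x v) := by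
  unfold value
  rcases arc_cell_iff.1 h with ⟨h1, h2⟩ | ⟨h1, h2, h3, h4⟩
  · have : ((v.2 : ℕ) : ℝ) = ((w.2 : ℕ) : ℝ) + 1 := by exact_mod_cast h2
    rw [h1, this]
    exact ⟨by linarith, fun h => (h rfl).elim⟩
  · have : ((w.2 : ℕ) : ℝ) + 1 = k := by exact_mod_cast h3
    rw [h2, Nat.cast_zero]
    exact ⟨by linarith, fun _ => by linarith⟩

theorem chainRank_lt_of_arc {v w : Fin n × Fin k} (h : Arc (cell k x) v w) :
    chainRank v < chainRank w := by
  rw [chainRank_lt_iff]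
  rcases arc_cell_iff.1 h with ⟨h1, h2⟩ | ⟨h1, -⟩
  · exact Or.inr ⟨h1, Fin.lt_def.2 (by omega)⟩
  · exact Or.inl h1

/-- An arc inside a label has length exactly 1 and every initial arc has length at least 1, so it
can contain no other arc and is never removed. -/
theorem diagramArc_of_eq_add_one (hx : IsGeneric k x) {v w : Fin n × Fin k} (h1 : v.1 = w.1)
    (h2 : (v.2 : ℕ) = (w.2 : ℕ) + 1) : DiagramArc (cell k x) v w := by
  rw [diagramArc_cell_iff hx]
  have h3 : value x v = value x w + 1 := by
    unfold value
    rw [h1, h2]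
    push_cast
    ring
  refine ⟨Or.inl ⟨h1, h2⟩, fun v' w' h hv hw => ?_⟩
  have := (value_of_arc h).1
  exact ⟨value_injective hx (by linarith), value_injective hx (by linarith)⟩

theorem exists_diagramArc_of_arc (hx : IsGeneric k x) {v w : Fin n × Fin k}
    (h : Arc (cell k x) v w) : ∃ v' w' : Fin n × Fin k, DiagramArc (cell k x) v' w' ∧
      value x v' ≤ value x v ∧ value x w ≤ value x w' := by
  classical
  obtain ⟨⟨v', w'⟩, hm, hmin⟩ := Finset.exists_min_image
    (Finset.univ.filter fun p : (Fin n × Fin k) × (Fin n × Fin k) =>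
      Arc (cell k x) p.1 p.2 ∧ value x p.1 ≤ value x v ∧ value x w ≤ value x p.2)
    (fun p => value x p.1 - value x p.2) ⟨(v, w), by simpa using h⟩
  simp only [Finset.mem_filter, Finset.mem_univ, true_and] at hm hmin
  refine ⟨v', w', (diagramArc_cell_iff hx).2 ⟨hm.1, fun a b hab ha hb => ?_⟩, hm.2⟩
  have := hmin (a, b) ⟨hab, ha.trans hm.2.1, hm.2.2.trans hb⟩
  exact ⟨value_injective hx (by linarith), value_injective hx (by linarith)⟩

theorem diagramArc_nonnesting (hx : IsGeneric k x) {v w v' w' : Fin n × Fin k}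
    (h : DiagramArc (cell k x) v w) (h' : DiagramArc (cell k x) v' w')
    (hlt : value x v' < value x v) : value x w' < value x w := by
  by_contra hle
  have := ((diagramArc_cell_iff hx).1 h).2 v' w' h'.1 hlt.le (not_lt.1 hle)
  rw [this.1] at hlt
  exact hlt.false

theorem diagramArc_right_unique (hx : IsGeneric k x) {v w w' : Fin n × Fin k}
    (h : DiagramArc (cell k x) v w) (h' : DiagramArc (cell k x) v w') : w = w' := by
  rcases le_total (value x w) (value x w') with hle | hle
  · exact (((diagramArc_cell_iff hx).1 h).2 v w' h'.1 le_rfl hle).2.symm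
  · exact (((diagramArc_cell_iff hx).1 h').2 v w h.1 le_rfl hle).2

theorem diagramArc_left_unique (hx : IsGeneric k x) {v v' w : Fin n × Fin k}
    (h : DiagramArc (cell k x) v w) (h' : DiagramArc (cell k x) v' w) : v = v' := by
  rcases le_total (value x v) (value x v') with hle | hle
  · exact (((diagramArc_cell_iff hx).1 h').2 v w h.1 hle le_rfl).1
  · exact (((diagramArc_cell_iff hx).1 h).2 v' w h'.1 hle le_rfl).1.symm

theorem sameChain_of_fst_eq (hx : IsGeneric k x) {v w : Fin n × Fin k} (h : v.1 = w.1) :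
    SameChain (cell k x) v w := by
  have H : ∀ d : ℕ, ∀ v w : Fin n × Fin k, v.1 = w.1 → (v.2 : ℕ) = (w.2 : ℕ) + d →
      SameChain (cell k x) v w := by
    intro d
    induction d with
    | zero =>
      intro v w h1 h2
      rw [Prod.ext h1 (Fin.ext h2)]
      exact Relation.EqvGen.refl _
    | succ d ih =>
      intro v w h1 h2
      have hv := v.2.isLt
      have h3 : DiagramArc (cell k x) v (v.1, ⟨w.2 + d, by omega⟩) :=
        diagramArc_of_eq_add_one hx rfl h2
      exact (Relation.EqvGen.rel _ _ h3).trans _ _ _ (ih _ w h1 rfl)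
  rcases le_total (w.2 : ℕ) (v.2 : ℕ) with hle | hle
  · exact H (v.2 - w.2) v w h (by omega)
  · exact (H (w.2 - v.2) w v h.symm (by omega)).symm

/-- Each variable has at most one outgoing and one incoming arc, so chains are directed paths. -/
theorem reflTransGen_of_sameChain (hx : IsGeneric k x) {v w : Fin n × Fin k}
    (h : SameChain (cell k x) v w) :
    Relation.ReflTransGen (DiagramArc (cell k x)) v w ∨
      Relation.ReflTransGen (DiagramArc (cell k x)) w v := by
  have hr : Relator.RightUnique (DiagramArc (cell k x) (k := k)) := fun _ _ _ =>
    diagramArc_right_unique hx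
  have hl : Relator.RightUnique (Function.swap (DiagramArc (cell k x) (k := k))) := fun _ _ _ =>
    diagramArc_left_unique hx
  induction h with
  | rel v w h => exact Or.inl (.single h)
  | refl v => exact Or.inl .refl
  | symm v w _ ih => exact ih.symm
  | trans a b c _ _ ih₁ ih₂ =>
    rcases ih₁ with h₁ | h₁ <;> rcases ih₂ with h₂ | h₂
    · exact Or.inl (h₁.trans h₂)
    · have := Relation.ReflTransGen.total_of_right_unique hl h₁.swap h₂.swap
      simpa only [Relation.reflTransGen_swap, or_comm] using this
    · exact Relation.ReflTransGen.total_of_right_unique hr h₁ h₂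
    · exact Or.inr (h₂.trans h₁)

theorem chainRank_le_of_reflTransGen {v w : Fin n × Fin k}
    (h : Relation.ReflTransGen (DiagramArc (cell k x)) v w) : chainRank v ≤ chainRank w := by
  induction h with
  | refl => exact le_rfl
  | tail _ h ih => exact ih.trans (chainRank_lt_of_arc h.1).le

theorem value_le_of_reflTransGen {v w : Fin n × Fin k}
    (h : Relation.ReflTransGen (DiagramArc (cell k x)) v w) : value x w ≤ value x v := by
  induction h with
  | refl => exact le_rfl
  | tail _ h ih =>
    have := (value_of_arc h.1).1
    linarith

theorem exists_position_eq_sigma (R : Set (Fin n → ℝ)) (v : Fin n × Fin k) :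
    ∃ (m : Fin k) (u : Fin n × Fin k), SameChain R (v.1, m) u ∧ sigma n k R v.1 = position R u :=
  Nat.sInf_mem (s := {p : ℕ | ∃ (m : Fin k) (u : Fin n × Fin k),
    SameChain R (v.1, m) u ∧ p = position R u})
    ⟨_, v.2, v, Relation.EqvGen.refl _, rfl⟩

theorem sigma_le_position (R : Set (Fin n → ℝ)) {v u : Fin n × Fin k} (h : SameChain R v u) :
    sigma n k R v.1 ≤ position R u :=
  Nat.sInf_le ⟨v.2, u, h, rfl⟩

theorem sameChain_iff_sigma_eq (hx : IsGeneric k x) {v w : Fin n × Fin k} :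
    SameChain (cell k x) v w ↔ sigma n k (cell k x) v.1 = sigma n k (cell k x) w.1 := by
  constructor
  · intro h
    unfold sigma
    congr 1
    ext p
    refine exists_congr fun m => exists_congr fun u => and_congr_left fun _ => ?_
    have h1 : SameChain (cell k x) (v.1, m) v := sameChain_of_fst_eq hx rfl
    have h2 : SameChain (cell k x) (w.1, m) w := sameChain_of_fst_eq hx rfl
    have h3 := (h1.trans _ _ _ h).trans _ _ _ h2.symm
    exact ⟨fun h4 => h3.symm.trans _ _ _ h4, fun h4 => h3.trans _ _ _ h4⟩
  · intro h
    obtain ⟨m, u, hu, hpu⟩ := exists_position_eq_sigma (cell k x) v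
    obtain ⟨m', u', hu', hpu'⟩ := exists_position_eq_sigma (cell k x) w
    obtain rfl : u = u' := position_injective hx (by rw [← hpu, ← hpu', h])
    have h1 : SameChain (cell k x) v (v.1, m) := sameChain_of_fst_eq hx rfl
    have h2 : SameChain (cell k x) w (w.1, m') := sameChain_of_fst_eq hx rfl
    exact (h1.trans _ _ _ hu).trans _ _ _ (h2.trans _ _ _ hu').symm

theorem diagramArc_iff_cov (hx : IsGeneric k x) {v w : Fin n × Fin k} :
    DiagramArc (cell k x) v w ↔ Cov (sigma n k (cell k x)) v w := by
  have key : ∀ {v u : Fin n × Fin k}, SameChain (cell k x) v u → chainRank v < chainRank u →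
      ∃ z, DiagramArc (cell k x) v z ∧ Relation.ReflTransGen (DiagramArc (cell k x)) z u := by
    intro v u hs hlt
    rcases reflTransGen_of_sameChain hx hs with h | h
    · rcases h.cases_head with rfl | h
      · exact hlt.false.elim
      · exact h
    · exact (hlt.not_ge (chainRank_le_of_reflTransGen h)).elim
  constructor
  · intro h
    have hs : SameChain (cell k x) v w := Relation.EqvGen.rel _ _ h
    refine ⟨(sameChain_iff_sigma_eq hx).1 hs, chainRank_lt_of_arc h.1, fun u hu => ?_⟩
    by_contra! hlt
    obtain ⟨z, hz, hzu⟩ := key ((sameChain_iff_sigma_eq hx).2 hu.symm) hlt.1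
    rw [diagramArc_right_unique hx hz h] at hzu
    exact hlt.2.not_ge (chainRank_le_of_reflTransGen hzu)
  · rintro ⟨h1, h2, h3⟩
    obtain ⟨z, hz, hzw⟩ := key ((sameChain_iff_sigma_eq hx).2 h1) h2
    have h4 := (sameChain_iff_sigma_eq hx).1 (Relation.EqvGen.rel _ _ hz)
    have h5 := chainRank_lt_of_arc hz.1
    have h6 := chainRank_le_of_reflTransGen hzw
    have h7 := h3 z h4.symm
    rwa [← chainRank_injective (show chainRank z = chainRank w by omega)]

theorem isChainPosition_position (hx : IsGeneric k x) :
    IsChainPosition (sigma n k (cell k x)) (position (cell k x) : Fin n × Fin k → ℕ) where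
  inj := position_injective hx
  one_le v := Nat.le_add_left 1 _
  le v := position_le _ ⟨x, mem_cell_self x⟩ v
  lt h := by
    have := (value_of_arc ((diagramArc_iff_cov hx).2 h).1).1
    exact position_lt_of_value_lt (by linarith)
  nonnesting h h' hlt := position_lt_of_value_lt <| diagramArc_nonnesting hx
    ((diagramArc_iff_cov hx).2 h) ((diagramArc_iff_cov hx).2 h') ((position_lt_iff hx).1 hlt)
  start v hv := by
    obtain ⟨m, u, hu, hpu⟩ := exists_position_eq_sigma (cell k x) v
    have h1 : SameChain (cell k x) v (v.1, m) := sameChain_of_fst_eq hx rfl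
    rcases reflTransGen_of_sameChain hx (h1.trans _ _ _ hu) with h | h
    -- Here the leftmost element `u` is reached from `v`, so it is not to the left of `v`; in the
    -- other case `v` has no predecessor, so the path from `u` to `v` is trivial.
    · refine le_antisymm ?_ (sigma_le_position _ (Relation.EqvGen.refl v))
      rw [hpu, position_le_iff hx]
      exact value_le_of_reflTransGen h
    · rcases h.cases_tail with rfl | ⟨z, -, hz⟩
      · exact hpu.symm
      · exact (hv z ((diagramArc_iff_cov hx).1 hz)).elim

end Generic

end ShiDiagram

/-! ### The parking condition -/

namespace ShiDiagram

variable {n k : ℕ}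

/-- Counting form of the condition on the sorted sequence, as used by the queue argument. -/
theorem isKParking_iff {f : Fin n → ℕ} :
    IsKParking k f ↔ (∀ i, 0 < f i) ∧
      ∀ j < n, j + 1 ≤ (Finset.univ.filter fun i => f i ≤ 1 + k * j).card := by
  have hmono := Tuple.monotone_sort f
  refine and_congr_right fun _ => ⟨fun h j hj => ?_, fun h i => ?_⟩
  · have hsub : (Finset.Iic (⟨j, hj⟩ : Fin n)).image (Tuple.sort f) ⊆
        Finset.univ.filter fun i => f i ≤ 1 + k * j := by
      intro a ha
      obtain ⟨i, hi, rfl⟩ := Finset.mem_image.1 ha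
      exact Finset.mem_filter.2 ⟨Finset.mem_univ _, (hmono (Finset.mem_Iic.1 hi)).trans (h _)⟩
    have := Finset.card_le_card hsub
    rwa [Finset.card_image_of_injective _ (Tuple.sort f).injective, Fin.card_Iic] at this
  · by_contra! hlt
    have hsub : (Finset.univ.filter fun a => f a ≤ 1 + k * (i : ℕ)) ⊆
        (Finset.Iio i).image (Tuple.sort f) := by
      intro a ha
      refine Finset.mem_image.2 ⟨(Tuple.sort f).symm a, ?_, Equiv.apply_symm_apply _ _⟩
      rw [Finset.mem_Iio]
      by_contra hle
      have h1 : f (Tuple.sort f i) ≤ f (Tuple.sort f ((Tuple.sort f).symm a)) :=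
        hmono (not_lt.1 hle)
      rw [Equiv.apply_symm_apply] at h1
      exact ((Finset.mem_filter.1 ha).2.trans_lt hlt).not_ge h1
    have h1 := Finset.card_le_card hsub
    rw [Finset.card_image_of_injective _ (Tuple.sort f).injective, Fin.card_Iio] at h1
    have h2 := h i i.isLt
    omega

namespace IsChainPosition

variable {f : Fin n → ℕ} {pos : Fin n × Fin k → ℕ}

theorem apply_le (h : IsChainPosition f pos) (v : Fin n × Fin k) : f v.1 ≤ pos v := by
  induction v using cov_induction (f := f) with
  | start v hv => exact (h.start v hv).ge
  | step u v huv ih => exact (huv.1 ▸ ih).trans (h.lt huv).le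

theorem exists_eq_apply (h : IsChainPosition f pos) (v : Fin n × Fin k) :
    ∃ u : Fin n × Fin k, f u.1 = f v.1 ∧ pos u = f v.1 := by
  obtain ⟨u, hu, hu'⟩ := exists_start f v
  exact ⟨u, hu, (h.start u hu').trans hu⟩

theorem isKParking (h : IsChainPosition f pos) (hk : 1 ≤ k) : IsKParking k f := by
  refine isKParking_iff.2 ⟨fun i => ?_, fun j hj => ?_⟩
  · obtain ⟨u, -, hu⟩ := h.exists_eq_apply (i, ⟨0, hk⟩)
    exact hu ▸ h.one_le u
  · have hle : 1 + k * j ≤ n * k := by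
      calc 1 + k * j ≤ k * (j + 1) := by rw [Nat.mul_add]; omega
        _ ≤ k * n := Nat.mul_le_mul_left k hj
        _ = n * k := mul_comm _ _
    -- A chain starts no later than any of its members, so the first `1 + k * j` positions hold only
    -- copies of labels with `f i ≤ 1 + k * j`. Each label has `k` copies, so more than `j` labels
    -- are needed.
    have hsub : Finset.Icc 1 (1 + k * j) ⊆
        ((Finset.univ.filter fun i => f i ≤ 1 + k * j) ×ˢ Finset.univ).image pos := by
      intro p hp
      obtain ⟨hp1, hp2⟩ := Finset.mem_Icc.1 hp
      obtain ⟨v, rfl⟩ := h.exists_eq hp1 (hp2.trans hle)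
      exact Finset.mem_image.2 ⟨v, by simpa using (h.apply_le v).trans hp2, rfl⟩
    have hcard := (Finset.card_le_card hsub).trans Finset.card_image_le
    rw [Nat.card_Icc, Finset.card_product, Finset.card_univ, Fintype.card_fin,
      mul_comm _ k] at hcard
    exact lt_of_mul_lt_mul_left (a := k) (by omega) (Nat.zero_le k)

end IsChainPosition

/-! ### Injectivity -/

theorem le_sub_of_lt_sub {x x' : Fin n → ℝ} (hx : IsGeneric k x) (hx' : IsGeneric k x')
    (hk : 1 ≤ k) (hpos : (position (cell k x) : Fin n × Fin k → ℕ) = position (cell k x'))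
    (harc : ∀ v w : Fin n × Fin k, DiagramArc (cell k x) v w → DiagramArc (cell k x') v w)
    {i j : Fin n} (hij : i < j) (h : (k : ℝ) < x i - x j) : (k : ℝ) ≤ x' i - x' j := by
  have ha : Arc (cell k x) ((i, ⟨0, hk⟩) : Fin n × Fin k) (j, ⟨k - 1, by omega⟩) :=
    arc_cell_iff.2 (Or.inr ⟨hij, rfl, Nat.sub_add_cancel hk, h⟩)
  -- The arc from `x_i` to `x_j + k - 1` may itself be removed, but a surviving arc inside it
  -- persists at `x'`. That arc may have length exactly 1, so only a weak inequality results;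
  -- genericity makes it strict later.
  obtain ⟨v, w, hvw, hv, hw⟩ := exists_diagramArc_of_arc hx ha
  rw [← position_le_iff hx, hpos, position_le_iff hx'] at hv hw
  have h1 := (value_of_arc (harc v w hvw).1).1
  simp only [value, Nat.cast_zero, Nat.cast_sub hk, Nat.cast_one] at hv hw h1
  linarith

theorem cell_eq_cell {x x' : Fin n → ℝ} (hx : IsGeneric k x) (hx' : IsGeneric k x')
    (hk : 1 ≤ k) (hpos : (position (cell k x) : Fin n × Fin k → ℕ) = position (cell k x'))
    (harc : ∀ v w : Fin n × Fin k, DiagramArc (cell k x) v w ↔ DiagramArc (cell k x') v w) :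
    cell k x = cell k x' := by
  refine cell_eq_of_mem hx fun i j hij l h1 h2 => ?_
  rcases h2.eq_or_lt with rfl | h2
  · have hne := hx' i j hij k h1 le_rfl
    push_cast at hne ⊢
    constructor <;> intro h
    · refine lt_of_not_ge fun hge => h.not_ge ?_
      exact le_sub_of_lt_sub hx' hx hk hpos.symm (fun v w => (harc v w).2) hij
        (lt_of_le_of_ne hge hne.symm)
    · exact lt_of_le_of_ne
        (le_sub_of_lt_sub hx hx' hk hpos (fun v w => (harc v w).1) hij h) hne.symm
  -- For `|l| < k` the side of the hyperplane is the comparison of `x_i + m` with `x_j + m'`.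
  · obtain ⟨m, m', rfl⟩ : ∃ m m' : Fin k, l = ((m' : ℕ) : ℤ) - ((m : ℕ) : ℤ) :=
      ⟨⟨(-l).toNat, by omega⟩, ⟨l.toNat, by omega⟩, by simp only; omega⟩
    have key : ∀ v w : Fin n × Fin k, value x v < value x w → value x' v < value x' w := by
      intro v w h
      rwa [← position_lt_iff hx', ← hpos, position_lt_iff hx]
    have k1 := key (i, m) (j, m')
    have k2 := key (j, m') (i, m)
    simp only [value] at k1 k2
    push_cast
    exact ⟨fun h => by linarith [k1 (by linarith)], fun h => by linarith [k2 (by linarith)]⟩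

theorem sigma_injOn (hk : 1 ≤ k) : Set.InjOn (sigma n k) (regions (extendedShi n k)) := by
  intro R hR R' hR' h
  obtain ⟨x, hx, rfl⟩ := mem_regions_iff.1 hR
  obtain ⟨x', hx', rfl⟩ := mem_regions_iff.1 hR'
  refine cell_eq_cell hx hx' hk ?_ fun v w => ?_
  · exact (isChainPosition_position hx).unique (h ▸ isChainPosition_position hx')
  · rw [diagramArc_iff_cov hx, diagramArc_iff_cov hx', h]

/-! ### Surjectivity -/

theorem sameChain_iff_of_diagramArc_iff_cov {f : Fin n → ℕ} {R : Set (Fin n → ℝ)}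
    (h : ∀ v w : Fin n × Fin k, DiagramArc R v w ↔ Cov f v w) {v w : Fin n × Fin k} :
    SameChain R v w ↔ f v.1 = f w.1 := by
  constructor
  · intro hvw
    induction hvw with
    | rel v w hvw => exact ((h v w).1 hvw).1
    | refl v => rfl
    | symm v w _ ih => exact ih.symm
    | trans a b c _ _ ih₁ ih₂ => exact ih₁.trans ih₂
  · have hstart : ∀ v : Fin n × Fin k, ∃ u, (∀ z, ¬ Cov f z u) ∧ f u.1 = f v.1 ∧
        SameChain R u v := by
      intro v
      induction v using cov_induction (f := f) with
      | start v hv => exact ⟨v, hv, rfl, Relation.EqvGen.refl v⟩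
      | step u v huv ih =>
        obtain ⟨z, hz, hzf, hzu⟩ := ih
        exact ⟨z, hz, hzf.trans huv.1, hzu.trans _ _ _ (.rel _ _ ((h u v).2 huv))⟩
    intro hf
    obtain ⟨u, hu, huf, huv⟩ := hstart v
    obtain ⟨u', hu', huf', huw⟩ := hstart w
    obtain rfl := eq_of_not_cov (huf.trans (hf.trans huf'.symm)) hu hu'
    exact huv.symm.trans _ _ _ huw

namespace IsChainPosition

variable {f : Fin n → ℕ} {pos : Fin n × Fin k → ℕ}

theorem sigma_eq (h : IsChainPosition f pos) (hk : 1 ≤ k) {R : Set (Fin n → ℝ)}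
    (hpos : position R = pos) (harc : ∀ v w : Fin n × Fin k, DiagramArc R v w ↔ Cov f v w) :
    sigma n k R = f := by
  funext i
  unfold sigma
  simp only [sameChain_iff_of_diagramArc_iff_cov harc, hpos]
  apply le_antisymm
  · obtain ⟨u, hu, hui⟩ := h.exists_eq_apply (i, ⟨0, hk⟩)
    exact Nat.sInf_le ⟨⟨0, hk⟩, u, hu.symm, hui.symm⟩
  · refine le_csInf ⟨_, ⟨0, hk⟩, (i, ⟨0, hk⟩), rfl, rfl⟩ ?_
    rintro _ ⟨m, v, hv, rfl⟩
    exact hv.trans_le (h.apply_le v)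

/-- The values of the variables at a point that realizes the numbering `pos` and the arcs between
consecutive variables of the chains of `f`. -/
theorem exists_value (h : IsChainPosition f pos) (hk : 1 ≤ k) : ∃ x : Fin n → ℝ,
    (∀ v w : Fin n × Fin k, pos v < pos w → value x w < value x v) ∧
    (∀ v w : Fin n × Fin k, Cov f v w → v.1 ≠ w.1 → value x w < value x v - 1) ∧
    (∀ v w : Fin n × Fin k, value x w ≤ value x v - 1 →
      ∃ v' w', Cov f v' w' ∧ pos v ≤ pos v' ∧ pos w' ≤ pos w) := by
  -- The strict arcs are those between different labels: there `x_i - (x_j + k - 1) > 1` amounts to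
  -- `x_i - x_j > k`.
  obtain ⟨y, hy⟩ := exists_real_of_nonnesting
    (E := fun p q => ∃ v w, Cov f v w ∧ pos v = p ∧ pos w = q)
    (fun p q => ∃ v w, pos v = p ∧ pos w = q ∧ v.1 ≠ w.1) (by
      rintro _ _ _ ⟨v, w, hvw, rfl, rfl⟩ ⟨v', w', hvw', hv', rfl⟩
      obtain rfl := h.inj hv'
      rw [hvw.right_unique hvw']) (by
      rintro _ _ _ _ ⟨v, w, hvw, rfl, rfl⟩ ⟨v', w', hvw', rfl, rfl⟩ hlt
      exact h.nonnesting hvw hvw' hlt) (n * k)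
  -- Arcs inside a label have length exactly 1, so the numbers at the copies of `i` are indeed `x_i,
  -- x_i + 1, …, x_i + k - 1`.
  have hval : ∀ (i : Fin n) (m : ℕ) (hm : m < k),
      value (fun i => y (pos (i, ⟨0, hk⟩))) (i, (⟨m, hm⟩ : Fin k)) = y (pos (i, ⟨m, hm⟩)) := by
    intro i m
    induction m with
    | zero => intro hm; simp [value]
    | succ m ih =>
      intro hm
      have hc : Cov f ((i, ⟨m + 1, hm⟩) : Fin n × Fin k) (i, ⟨m, by omega⟩) :=
        cov_of_eq_add_one f rfl rfl
      have h1 := (hy _ _ (h.lt hc) (h.le _)).2.2.2.2 ⟨_, _, hc, rfl, rfl⟩ (by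
        rintro ⟨v, w, hv, hw, hne⟩
        rw [h.inj hv, h.inj hw] at hne
        exact hne rfl)
      have h2 := ih (by omega)
      simp only [value] at h2 ⊢
      push_cast
      linarith
  refine ⟨fun i => y (pos (i, ⟨0, hk⟩)), ?_⟩
  have hval' : ∀ v : Fin n × Fin k, value (fun i => y (pos (i, ⟨0, hk⟩))) v = y (pos v) :=
    fun v => hval v.1 v.2 v.2.isLt
  simp only [hval']
  refine ⟨fun v w hlt => (hy _ _ hlt (h.le w)).1, fun v w hc hne =>
    (hy _ _ (h.lt hc) (h.le w)).2.2.2.1 ⟨v, w, hc, rfl, rfl⟩ ⟨v, w, rfl, rfl, hne⟩,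
    fun v w hvw => ?_⟩
  rcases lt_or_ge (pos v) (pos w) with hlt | hge
  · by_contra hno
    refine ((hy _ _ hlt (h.le w)).2.2.1 ?_).not_ge hvw
    rintro ⟨_, _, ⟨v', w', hc, rfl, rfl⟩, h1, h2⟩
    exact hno ⟨v', w', hc, h1, h2⟩
  · exfalso
    rcases hge.eq_or_lt with heq | hlt
    · rw [heq] at hvw
      linarith
    · linarith [(hy _ _ hlt (h.le v)).1]

theorem exists_region (h : IsChainPosition f pos) (hk : 1 ≤ k) :
    ∃ x : Fin n → ℝ, IsGeneric k x ∧ sigma n k (cell k x) = f := by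
  obtain ⟨x, hlt, hcov, hex⟩ := h.exists_value hk
  have hlt_iff : ∀ {v w}, value x w < value x v ↔ pos v < pos w := by
    intro v w
    refine ⟨fun hvw => ?_, hlt v w⟩
    rcases lt_trichotomy (pos v) (pos w) with h1 | h1 | h1
    · exact h1
    · rw [h.inj h1] at hvw
      exact hvw.false.elim
    · exact (hvw.not_gt (hlt w v h1)).elim
  have hle_iff : ∀ {v w}, value x w ≤ value x v ↔ pos v ≤ pos w := by
    intro v w
    rw [← not_lt, hlt_iff, not_lt]
  have hinj : ∀ {v w : Fin n × Fin k}, value x v = value x w → v = w := fun hvw =>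
    h.inj (le_antisymm (hle_iff.1 hvw.ge) (hle_iff.1 hvw.le))
  have hcov_le : ∀ {v w : Fin n × Fin k}, Cov f v w → value x w ≤ value x v - 1 := by
    intro v w hc
    rcases hc.cases with ⟨h1, h2⟩ | ⟨h1, -⟩
    · simp only [value, h1, h2]
      push_cast
      linarith
    · exact (hcov v w hc h1.ne).le
  have hx : IsGeneric k x := by
    intro i j hij l h1 h2 heq
    rcases h2.eq_or_lt with rfl | h2
    -- If `x_i - x_j = k`, some arc lies between two variables at distance exactly 1. It must join
    -- these two, but arcs between different labels are longer than 1.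
    · have e : value x ((j, ⟨k - 1, by omega⟩) : Fin n × Fin k) =
          value x ((i, ⟨0, hk⟩) : Fin n × Fin k) - 1 := by
        simp only [value, Nat.cast_sub hk]
        push_cast at heq ⊢
        linarith
      obtain ⟨v, w, hc, h3, h4⟩ := hex _ _ e.le
      have h5 := hle_iff.2 h3
      have h6 := hle_iff.2 h4
      have h7 := hcov_le hc
      obtain rfl := hinj (show value x v = value x (i, ⟨0, hk⟩) by linarith)
      obtain rfl := hinj (show value x w = value x (j, ⟨k - 1, Nat.sub_lt hk one_pos⟩) by linarith)
      exact (hcov _ _ hc hij.ne).ne e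
    · obtain ⟨m, m', rfl⟩ : ∃ m m' : Fin k, l = ((m' : ℕ) : ℤ) - ((m : ℕ) : ℤ) :=
        ⟨⟨(-l).toNat, by omega⟩, ⟨l.toNat, by omega⟩, by simp only; omega⟩
      have e : value x (i, m) = value x (j, m') := by
        simp only [value]
        push_cast at heq
        linarith
      exact hij.ne (congrArg Prod.fst (hinj e))
  have hpos : position (cell k x) = pos := by
    funext v
    rw [← h.card_lt v]
    unfold position
    simp only [left_cell_iff, hlt_iff]
  have harc : ∀ {v w : Fin n × Fin k}, Cov f v w → Arc (cell k x) v w := by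
    intro v w hc
    rw [arc_cell_iff]
    rcases hc.cases with h1 | ⟨h1, h2, h3⟩
    · exact Or.inl h1
    · refine Or.inr ⟨h1, h2, h3, ?_⟩
      have h4 := hcov v w hc h1.ne
      have h5 : ((w.2 : ℕ) : ℝ) + 1 = k := by exact_mod_cast h3
      simp only [value, h2, Nat.cast_zero] at h4
      linarith
  refine ⟨x, hx, h.sigma_eq hk hpos fun v w => ⟨fun hd => ?_, fun hc => ?_⟩⟩
  · obtain ⟨v', w', hc, h1, h2⟩ := hex v w (by linarith [(value_of_arc hd.1).1])
    obtain ⟨rfl, rfl⟩ := ((diagramArc_cell_iff hx).1 hd).2 v' w' (harc hc) (hle_iff.2 h1)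
      (hle_iff.2 h2)
    exact hc
  · refine (diagramArc_cell_iff hx).2 ⟨harc hc, fun v' w' ha hv hw => ?_⟩
    -- Any initial arc inside `v → w` has length at least 1, hence contains a chain arc `a → b`.
    -- Nonnesting forces this to be `v → w`, and the arc in between coincides with it.
    obtain ⟨a, b, hab, h1, h2⟩ := hex v' w' (by linarith [(value_of_arc ha).1])
    have h3 := hle_iff.1 hv
    have h4 := hle_iff.1 hw
    have h5 : pos a ≤ pos v := by
      by_contra hgt
      have := h.nonnesting hc hab (not_le.1 hgt)
      omega
    obtain rfl := h.inj (show pos a = pos v by omega)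
    obtain rfl := hab.right_unique hc
    exact ⟨h.inj (by omega), h.inj (by omega)⟩

end IsChainPosition

end ShiDiagram

theorem theorem3p4 (n k : ℕ) (hk : 1 ≤ k) :
    Set.BijOn (sigma n k) (regions (extendedShi n k)) {f : Fin n → ℕ | IsKParking k f} := by
  refine ⟨fun R hR => ?_, ShiDiagram.sigma_injOn hk, fun f hf => ?_⟩
  · obtain ⟨x, hx, rfl⟩ := ShiDiagram.mem_regions_iff.1 hR
    exact (ShiDiagram.isChainPosition_position hx).isKParking hk
  · obtain ⟨hpos, hcount⟩ := ShiDiagram.isKParking_iff.1 hf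
    obtain ⟨pos, h⟩ := ShiDiagram.exists_isChainPosition (k := k) hpos hcount
    obtain ⟨x, hx, hsigma⟩ := h.exists_region hk
    exact ⟨_, ShiDiagram.mem_regions_iff.2 ⟨x, hx, rfl⟩, hsigma⟩
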